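/- **Setting.** Let $m\ge 2$ and $n\ge 2$ be integers and $k,\delta>0$ reals. A network has $n+2$ nodes: a source $S$, a destination $D$ and relays $R_1,\dots,R_n$. Each node has an interest profile, a unit vector in $\mathbb{R}^m$ with nonnegative coordinates. Source and destination have the orthogonal profiles $S=(1,0,\dots,0)$ and $D=(0,1,0,\dots,0)$. The profiles of $R_1,\dots,R_n$ are independent and identically distributed: the angle between $R_i$ and $S$ is uniform on $[0,\pi/2]$, and given this angle, $R_i$ is uniformly distributed among all unit vectors with nonnegative coordinates that make this angle with $S$. Given the profiles, the meetings of the pairs $\{A,B\}$ of distinct nodes are independent Poisson processes on $[0,\infty)$, the one of $\{A,B\}$ with intensity $\lambda_{AB}=k\cos(\angle AB)+\delta$ (interest-based mobility). FirstMeeting routing (BinarySW with $2$ copies) delivers a message from $S$ to $D$ as follows. If $S$ meets $D$ before meeting any relay, the message is delivered at that meeting. Otherwise $S$ gives a copy to the first relay $R_j$ that it meets, and the message is delivered at the first later time at which $S$ or $R_j$ meets $D$. Let $T_{FM}^{ib}$ be the delivery time. **Theorem.** Let $K>0$. 1. There are constants $c,c'>0$, depending only on $K$, such that for all $m\ge 2$,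 $n\ge2$, $0<k\le K$ and $\delta>0$, $$\mathbb{E}[T_{FM}^{ib}]\ \ge\ \min\Big\{c\,\log\frac1\delta,\ c'\,\frac{n}{\log n}\Big\}.$$ In particular, for fixed $k$ and $m$ and any sequence $\delta=\delta(n)>0$, $\mathbb{E}[T_{FM}^{ib}]\ge\min\{\Omega(\log(1/\delta)),\Omega(n/\log n)\}$. 2. Let $m\ge2$ be fixed, and let $k=k(n)\in(0,K]$ and $\delta=\delta(n)>0$ with $\delta(n)\to0$ as $n\to\infty$. Then $\mathbb{E}[T_{FM}^{ib}]\to\infty$ as $n\to\infty$. -/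

import Mathlib

open MeasureTheory ProbabilityTheory Filter Topology
open scoped ENNReal

noncomputable section

namespace PSN

/-- The unit sphere of `ℝ^m` (Euclidean norm). -/
abbrev UnitSphere (m : ℕ) : Type := Metric.sphere (0 : EuclideanSpace ℝ (Fin m)) 1

/-- Interest profiles with `m` interests: unit vectors of `ℝ^m` all of whose
coordinates are nonnegative. -/
abbrev Profile (m : ℕ) : Type := {x : UnitSphere m // ∀ i, 0 ≤ x.1 i}

/-- The vector of interests of a profile. -/
abbrev Profile.vec {m : ℕ} (x : Profile m) : EuclideanSpace ℝ (Fin m) := x.1.1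

/-- The cosine similarity of two profiles. -/
def Profile.similarity {m : ℕ} (x y : Profile m) : ℝ :=
  Real.cos (InnerProductGeometry.angle x.vec y.vec)

/-- The profile whose only interest is the `i`-th one. -/
def Profile.pure {m : ℕ} (i : Fin m) : Profile m :=
  ⟨⟨EuclideanSpace.single i 1, by simp⟩, fun j => by
    by_cases h : j = i <;> simp [h]⟩

/-- The profile making the angle `α` with the first coordinate axis, and whose component orthogonal
to that axis has the direction `u`: the vector `(cos α, sin α • u)`. -/
def Profile.polar {m : ℕ} (α : Set.Icc (0 : ℝ) (Real.pi / 2)) (u : Profile m) : Profile (m + 1) :=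
  ⟨⟨WithLp.toLp 2 (Fin.cons (Real.cos α) fun i => Real.sin α * u.vec i), by
    have hu : ∑ i, u.vec i ^ 2 = 1 := by
      have h := EuclideanSpace.real_norm_sq_eq u.vec
      rw [mem_sphere_zero_iff_norm.1 u.1.2] at h
      simpa using h.symm
    have h := EuclideanSpace.real_norm_sq_eq
      (WithLp.toLp 2 (Fin.cons (Real.cos α) fun i => Real.sin α * u.vec i) :
        EuclideanSpace ℝ (Fin (m + 1)))
    simp only [Fin.sum_univ_succ, Fin.cons_zero, Fin.cons_succ, mul_pow, ← Finset.mul_sum, hu,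
      mul_one, Real.cos_sq_add_sin_sq] at h
    rw [mem_sphere_zero_iff_norm]
    exact (pow_eq_one_iff_of_nonneg (norm_nonneg _) two_ne_zero).1 h⟩, fun i => by
    refine Fin.cases ?_ (fun j => ?_) i
    · exact Real.cos_nonneg_of_neg_pi_div_two_le_of_le
        (by linarith [α.2.1, Real.pi_pos]) α.2.2
    · exact mul_nonneg (Real.sin_nonneg_of_nonneg_of_le_pi α.2.1
        (by linarith [α.2.2, Real.pi_pos])) (u.2 j)⟩

/-- The uniform distribution on the angles `[0, π/2]`. -/
def angleLaw : Measure (Set.Icc (0 : ℝ) (Real.pi / 2)) :=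
  cond ((volume : Measure ℝ).comap Subtype.val) Set.univ

/-- The uniform distribution on the positive orthant of the unit sphere of `ℝ^m`: the surface
measure of the sphere, restricted to the orthant and normalised. -/
def orthantLaw (m : ℕ) : Measure (Profile m) :=
  cond ((volume : Measure (EuclideanSpace ℝ (Fin m))).toSphere.comap Subtype.val) Set.univ

/-- The law of the profile of a relay node with `d + 2` interests: the angle with the first axis
(the profile of the source) is uniform on `[0, π/2]`; given the angle, the profile is uniform among
all profiles that make this angle with the first axis. -/
def profileLaw (d : ℕ) : Measure (Profile (d + 2)) :=
  (angleLaw.prod (orthantLaw (d + 1))).map fun p => Profile.polar p.1 p.2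

instance : IsProbabilityMeasure angleLaw := by
  have h : ((volume : Measure ℝ).comap Subtype.val :
      Measure (Set.Icc (0 : ℝ) (Real.pi / 2))) Set.univ = ENNReal.ofReal (Real.pi / 2) := by
    rw [(MeasurableEmbedding.subtype_coe measurableSet_Icc).comap_apply]
    rw [Set.image_univ, Subtype.range_coe, Real.volume_Icc, sub_zero]
  refine cond_isProbabilityMeasure_of_finite ?_ ?_
  · rw [h]; simp [Real.pi_pos]
  · rw [h]; exact ENNReal.ofReal_ne_top

instance (m : ℕ) : IsProbabilityMeasure (orthantLaw (m + 1)) := by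
  have hc : ∀ i, Continuous fun x : UnitSphere (m + 1) => x.1 i := fun i => by fun_prop
  have hm : MeasurableSet {x : UnitSphere (m + 1) | ∀ i, 0 ≤ x.1 i} := by
    rw [Set.ofPred_forall]
    exact (isClosed_iInter fun i => isClosed_le continuous_const (hc i)).measurableSet
  have hemb := MeasurableEmbedding.subtype_coe hm
  let σ : Measure (UnitSphere (m + 1)) :=
    (volume : Measure (EuclideanSpace ℝ (Fin (m + 1)))).toSphere
  have h : σ.comap (Subtype.val : Profile (m + 1) → UnitSphere (m + 1)) Set.univ =
      σ (Subtype.val '' (Set.univ : Set (Profile (m + 1)))) := hemb.comap_apply σ Set.univ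
  refine cond_isProbabilityMeasure_of_finite (fun h0 => ?_) ?_
  · replace h0 := h.symm.trans h0
    have ho : IsOpen {x : UnitSphere (m + 1) | ∀ i, 0 < x.1 i} := by
      rw [Set.ofPred_forall]
      exact isOpen_iInter_of_finite fun i => isOpen_lt continuous_const (hc i)
    have hne : {x : UnitSphere (m + 1) | ∀ i, 0 < x.1 i}.Nonempty := by
      let v : EuclideanSpace ℝ (Fin (m + 1)) := WithLp.toLp 2 fun _ => 1
      have hv : 0 < ‖v‖ := norm_pos_iff.2 fun hv => by
        have := congrArg (fun w : EuclideanSpace ℝ (Fin (m + 1)) => w 0) hv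
        simp [v] at this
      refine ⟨⟨‖v‖⁻¹ • v, ?_⟩, fun i => ?_⟩
      · rw [mem_sphere_zero_iff_norm, norm_smul, norm_inv, norm_norm, inv_mul_cancel₀ hv.ne']
      · have : 0 < ‖v‖⁻¹ * 1 := by positivity
        exact this
    refine ho.measure_ne_zero σ hne (measure_mono_null ?_ h0)
    intro x hx
    exact ⟨⟨x, fun i => (hx i).le⟩, trivial, rfl⟩
  · exact fun h0 => measure_ne_top σ _ (h.symm.trans h0)

theorem Profile.continuous_polar (m : ℕ) :
    Continuous fun p : Set.Icc (0 : ℝ) (Real.pi / 2) × Profile m => Profile.polar p.1 p.2 := by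
  refine Continuous.subtype_mk (Continuous.subtype_mk ?_ _) _
  refine (PiLp.continuous_toLp 2 _).comp (continuous_pi fun i => ?_)
  refine Fin.cases ?_ (fun j => ?_) i
  · simp only [Fin.cons_zero]; fun_prop
  · simp only [Fin.cons_succ, Profile.vec]; fun_prop

instance (d : ℕ) : IsProbabilityMeasure (profileLaw d) :=
  Measure.isProbabilityMeasure_map (Profile.continuous_polar _).measurable.aemeasurable

/-- The `n + 2` nodes of the network: source, destination and `n` relay nodes. -/
inductive Node (n : ℕ) : Type
  | S : Node n
  | D : Node n
  | R : Fin n → Node n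

/-- The profiles of all nodes. Source and destination have the orthogonal profiles `(1,0,…,0)`
and `(0,1,0,…,0)`. -/
def nodeProfile {d n : ℕ} (r : Fin n → Profile (d + 2)) : Node n → Profile (d + 2)
  | .S => Profile.pure 0
  | .D => Profile.pure 1
  | .R i => r i

/-- The parameters of interest-based mobility, for a given number of nodes. -/
structure Mobility where
  k : ℝ
  δ : ℝ
  k_pos : 0 < k
  δ_pos : 0 < δ

/-- The meeting rate of two nodes under interest-based mobility,
`λ_AB = k cos(∠AB) + δ`. -/
def Mobility.rate (p : Mobility) {d n : ℕ} (r : Fin n → Profile (d + 2)) : Sym2 (Node n) → ℝ :=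
  Sym2.lift ⟨fun A B => p.k * (nodeProfile r A).similarity (nodeProfile r B) + p.δ, fun A B => by
    simp only [Profile.similarity, InnerProductGeometry.angle_comm]⟩

theorem Profile.similarity_eq {m : ℕ} (x y : Profile m) :
    x.similarity y = ∑ i, x.vec i * y.vec i := by
  rw [Profile.similarity, InnerProductGeometry.cos_angle, mem_sphere_zero_iff_norm.1 x.1.2,
    mem_sphere_zero_iff_norm.1 y.1.2, mul_one, div_one, PiLp.inner_apply]
  simp [mul_comm]

theorem Profile.similarity_nonneg {m : ℕ} (x y : Profile m) : 0 ≤ x.similarity y := by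
  rw [Profile.similarity_eq]
  exact Finset.sum_nonneg fun i _ => mul_nonneg (x.2 i) (y.2 i)

theorem Mobility.rate_pos (p : Mobility) {d n : ℕ} (r : Fin n → Profile (d + 2))
    (e : Sym2 (Node n)) : 0 < p.rate r e := by
  induction e with
  | h A B =>
    exact add_pos_of_nonneg_of_pos
      (mul_nonneg p.k_pos.le (Profile.similarity_nonneg _ _)) p.δ_pos

instance (p : Mobility) {d n : ℕ} (r : Fin n → Profile (d + 2)) (e : Sym2 (Node n)) :
    IsProbabilityMeasure (expMeasure (p.rate r e)) :=
  isProbabilityMeasure_expMeasure (p.rate_pos r e)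

theorem Mobility.measurable_rate (p : Mobility) {d n : ℕ} (e : Sym2 (Node n)) :
    Measurable fun r : Fin n → Profile (d + 2) => p.rate r e := by
  have hn : ∀ A : Node n, ∀ i, Measurable fun r : Fin n → Profile (d + 2) =>
      (nodeProfile r A).vec i := by
    intro A i
    cases A with
    | S => exact measurable_const
    | D => exact measurable_const
    | R j =>
      have : Continuous fun x : Profile (d + 2) => x.vec i := by
        unfold Profile.vec; fun_prop
      exact this.measurable.comp (measurable_pi_apply j)
  induction e with
  | h A B =>
    simp only [Mobility.rate, Sym2.lift_mk, Profile.similarity_eq]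
    exact ((Finset.measurable_sum _ fun i _ => (hn A i).mul (hn B i)).const_mul _).add_const _

/-- The gaps between meetings: for every pair of nodes, the sequence of waiting times between
consecutive meetings of this pair. (The entries of diagonal pairs are never used.) -/
abbrev Gaps (n : ℕ) : Type := Sym2 (Node n) × ℕ → ℝ

theorem measurable_expMeasure_apply {s : Set ℝ} (hs : MeasurableSet s) :
    Measurable fun r : ℝ => expMeasure r s := by
  have h : (fun r : ℝ => expMeasure r s) = fun r => ∫⁻ x in s, exponentialPDF r x := by
    funext r
    exact withDensity_apply _ hs
  rw [h]
  simp_rw [exponentialPDF_eq]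
  apply Measurable.lintegral_prod_right' (f := fun q : ℝ × ℝ =>
    ENNReal.ofReal (if 0 ≤ q.2 then q.1 * Real.exp (-(q.1 * q.2)) else 0))
  refine ENNReal.measurable_ofReal.comp (Measurable.ite ?_ (by fun_prop) measurable_const)
  exact measurableSet_le measurable_const measurable_snd

/-- The law of the meetings given the profiles of the relay nodes: the meetings of distinct pairs
are independent, and the meetings of the pair `AB` form a Poisson process of intensity `λ_AB`
(independent exponential gaps of rate `λ_AB`). -/
def Mobility.meetingLaw (p : Mobility) (d n : ℕ) : Kernel (Fin n → Profile (d + 2)) (Gaps n) where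
  toFun r := Measure.infinitePi fun e => expMeasure (p.rate r e.1)
  measurable' := by
    refine Measurable.measure_of_isPiSystem_of_isProbabilityMeasure
      generateFrom_squareCylinders.symm
      (isPiSystem_squareCylinders (fun _ => MeasurableSpace.isPiSystem_measurableSet) (by simp)) ?_
    rintro _ ⟨s, t, ht, rfl⟩
    have ht' : ∀ i ∈ s, MeasurableSet (t i) := fun i _ => ht i (Set.mem_univ i)
    simp_rw [Measure.infinitePi_pi _ ht']
    exact Finset.measurable_prod _ fun i hi =>
      (measurable_expMeasure_apply (ht' i hi)).comp (p.measurable_rate i.1)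

instance (p : Mobility) (d n : ℕ) : IsMarkovKernel (p.meetingLaw d n) :=
  ⟨fun r => by
    change IsProbabilityMeasure
      (Measure.infinitePi fun e : Sym2 (Node n) × ℕ => expMeasure (p.rate r e.1))
    infer_instance⟩

/-- The joint law of the profiles of the relay nodes (independent, each of law `profileLaw`) and of
the meetings under interest-based mobility. -/
def Mobility.law (p : Mobility) (d n : ℕ) : Measure ((Fin n → Profile (d + 2)) × Gaps n) :=
  (Measure.pi fun _ : Fin n => profileLaw d).compProd (p.meetingLaw d n)

instance (p : Mobility) (d n : ℕ) : IsProbabilityMeasure (p.law d n) := by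
  unfold Mobility.law; infer_instance

/-- The time of the `i`-th meeting (counted from `0`) of `A` and `B`. -/
def meetingTime {n : ℕ} (g : Gaps n) (A B : Node n) (i : ℕ) : ℝ≥0∞ :=
  ENNReal.ofReal (∑ l ∈ Finset.range (i + 1), g (s(A, B), l))

/-- The time of the first meeting of `A` and `B` after time `t`. -/
def nextMeeting {n : ℕ} (g : Gaps n) (A B : Node n) (t : ℝ≥0∞) : ℝ≥0∞ :=
  ⨅ (i : ℕ) (_ : t < meetingTime g A B i), meetingTime g A B i

/-- The time at which the source first meets a relay node. -/
def relayTime {n : ℕ} (g : Gaps n) : ℝ≥0∞ :=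
  ⨅ j : Fin n, meetingTime g .S (.R j) 0

open Classical in
/-- The delivery time of FirstMeeting routing. If the source meets the destination before any relay
node, then the message is delivered at that meeting. Otherwise the second copy is given to the
relay node `R j` that the source meets first, and the message is delivered at the first later
meeting of the destination with the source or with `R j`. (Two relay nodes tie for being met first
with probability zero; the infimum over `j` has just one term otherwise.) -/
def deliveryTimeFM {n : ℕ} (g : Gaps n) : ℝ≥0∞ :=
  if meetingTime g .S .D 0 ≤ relayTime g then meetingTime g .S .D 0
  else ⨅ (j : Fin n) (_ : meetingTime g .S (.R j) 0 = relayTime g),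
    min (nextMeeting g .S .D (relayTime g)) (nextMeeting g (.R j) .D (relayTime g))

/-- The expected delivery time of FirstMeeting routing under interest-based mobility, with `d + 2`
interests and `n` relay nodes. -/
def Mobility.expectedTimeFM (p : Mobility) (d n : ℕ) : ℝ≥0∞ :=
  ∫⁻ ω, deliveryTimeFM ω.2 ∂(p.law d n)

end PSN

end

namespace PSN

/-! A relay similar to the source is met first with probability of order `1 / n`, and a relay making
a small angle `α` with the source is nearly orthogonal to the destination: its rate of meeting the
destination is at most `k α + δ`. Once such a relay holds the second copy, delivery takes time of
order `1 / (2δ + k α)`. The angle is uniform, so averaging gives a multiple of `∫₀¹ dα / (2δ + K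
α)`, which is of order `log (1 / δ)`.

To make this rigorous, fix the profiles and let `R j` satisfy `cos ∠ ≥ 1/2` with the source. The
event `relayEvent` constrains only the first meetings of distinct pairs, so its probability is a
product of exponential probabilities and is at least `e⁻² / (4n)`
(`Mobility.meetingLaw_relayEvent_ge`). It forces late delivery (`le_deliveryTimeFM`). The events for
different `j` are disjoint, so their contributions add up and the factor `n` cancels
(`Mobility.lintegral_relayDelay_le_expectedTimeFM`). What remains is the integral over one profile
(`Mobility.lintegral_relayDelay_ge`).

The logarithmic bound thus holds for every `n ≥ 1`; the term `n / log n` in the minimum is never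
needed. -/

/-! ### Exponential laws and finite cylinders -/

theorem expMeasure_Iic {r t : ℝ} (hr : 0 < r) (ht : 0 ≤ t) :
    expMeasure r (Set.Iic t) = ENNReal.ofReal (1 - Real.exp (-(r * t))) := by
  have := isProbabilityMeasure_expMeasure hr
  rw [← ofReal_cdf, cdf_expMeasure_eq hr, if_pos ht]

theorem expMeasure_Ioi {r t : ℝ} (hr : 0 < r) (ht : 0 ≤ t) :
    expMeasure r (Set.Ioi t) = ENNReal.ofReal (Real.exp (-(r * t))) := by
  have := isProbabilityMeasure_expMeasure hr
  have h1 : Real.exp (-(r * t)) ≤ 1 := Real.exp_le_one_iff.2 (by nlinarith)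
  rw [← Set.compl_Iic, prob_compl_eq_one_sub measurableSet_Iic, expMeasure_Iic hr ht,
    ← ENNReal.ofReal_one, ← ENNReal.ofReal_sub _ (by linarith)]
  congr 1; ring

theorem ae_nonneg_expMeasure {r : ℝ} (hr : 0 < r) : ∀ᵐ x ∂expMeasure r, 0 ≤ x := by
  have h : expMeasure r (Set.Iic 0) = 0 := by simp [expMeasure_Iic hr le_rfl]
  refine measure_mono_null (fun x hx => ?_) h
  exact (not_le.1 (show ¬(0 : ℝ) ≤ x from hx)).le

/-- The product measure of a cylinder given by finitely many distinct coordinates. -/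
theorem infinitePi_forall_mem {ι κ : Type*} [Fintype κ] {X : ι → Type*}
    [∀ i, MeasurableSpace (X i)] (μ : ∀ i, Measure (X i)) [∀ i, IsProbabilityMeasure (μ i)]
    {φ : κ → ι} (hφ : Function.Injective φ) {t : ∀ x, Set (X (φ x))}
    (ht : ∀ x, MeasurableSet (t x)) :
    Measure.infinitePi μ {g | ∀ x, g (φ x) ∈ t x} = ∏ x, μ (φ x) (t x) := by
  classical
  -- `T` is `t x` at `φ x` (by injectivity the intersection has one term) and the whole space off
  -- the range of `φ`.
  let T : ∀ i, Set (X i) := fun i => ⋂ (x : κ) (h : φ x = i), h ▸ t x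
  have hT : ∀ x, T (φ x) = t x := fun x => by
    ext y
    simp only [T, Set.mem_iInter]
    refine ⟨fun h => h x rfl, fun h z hz => ?_⟩
    obtain rfl := hφ hz
    exact h
  have hset : {g : ∀ i, X i | ∀ x, g (φ x) ∈ t x} =
      Set.pi ((Finset.univ.map ⟨φ, hφ⟩ : Finset ι) : Set ι) T := by
    ext g
    simp [Set.mem_pi, hT]
  rw [hset, Measure.infinitePi_pi, Finset.prod_map]
  · simp [hT]
  · intro i hi
    obtain ⟨x, -, rfl⟩ := Finset.mem_map.1 hi
    simpa [hT] using ht x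

/-! ### Events that force a late delivery -/

variable {d n : ℕ}

theorem meetingTime_zero (g : Gaps n) (A B : Node n) :
    meetingTime g A B 0 = ENNReal.ofReal (g (s(A, B), 0)) := by
  simp [meetingTime]

/-- Every meeting time is a partial sum of nonnegative gaps that includes the first gap. This bounds
the wait after the copy is handed over without appeal to the memoryless property. -/
theorem meetingTime_zero_le_nextMeeting {g : Gaps n} {A B : Node n}
    (hg : ∀ l, 0 ≤ g (s(A, B), l)) (t : ℝ≥0∞) :
    meetingTime g A B 0 ≤ nextMeeting g A B t := by
  refine le_iInf₂ fun i _ => ENNReal.ofReal_le_ofReal ?_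
  exact Finset.sum_le_sum_of_subset_of_nonneg (by simp) fun l _ _ => hg l

/-- The pairs whose first meetings decide whether `R j` is the first relay met by the source, and
how long it takes the source or `R j` to meet the destination. -/
def decisivePair (j : Fin n) : Fin n ⊕ Bool → Sym2 (Node n)
  | .inl i => s(.S, .R i)
  | .inr true => s(.S, .D)
  | .inr false => s(.R j, .D)

/-- Distinctness of the pairs is what makes their first meetings independent. -/
theorem decisivePair_injective (j : Fin n) : Function.Injective (decisivePair j) := by
  rintro (a | _ | _) (b | _ | _) h <;> simp_all [decisivePair]

/-- The source meets `R j` up to time `t` and all other relay nodes later than `t`; the destination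
meets neither the source nor `R j` up to time `τ`. -/
def relayEvent (j : Fin n) (t τ : ℝ) : Set (Gaps n) :=
  {g | ∀ x, g (decisivePair j x, 0) ∈
    (Sum.elim (fun i => if i = j then Set.Iic t else Set.Ioi t) (fun _ => Set.Ioi τ) x : Set ℝ)}

theorem mem_relayEvent {j : Fin n} {t τ : ℝ} {g : Gaps n} :
    g ∈ relayEvent j t τ ↔
      (∀ i, g (s(.S, .R i), 0) ∈ if i = j then Set.Iic t else Set.Ioi t) ∧
        τ < g (s(.S, .D), 0) ∧ τ < g (s(.R j, .D), 0) := by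
  simp [relayEvent, decisivePair, and_comm]

/-- The common threshold `t` separates the first relay met from all others, whatever the two delays
are. -/
theorem eq_of_mem_relayEvent {i j : Fin n} {t σ τ : ℝ} {g : Gaps n} (hi : g ∈ relayEvent i t σ)
    (hj : g ∈ relayEvent j t τ) : i = j := by
  by_contra h
  have h1 := (mem_relayEvent.1 hi).1 i
  have h2 := (mem_relayEvent.1 hj).1 i
  simp only [if_true, if_neg h, Set.mem_Iic, Set.mem_Ioi] at h1 h2
  exact absurd h1 (not_le.2 h2)

theorem le_deliveryTimeFM {j : Fin n} {t τ : ℝ} (ht : 0 < t) {g : Gaps n} (hg : ∀ e, 0 ≤ g e)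
    (hj : g ∈ relayEvent j t τ) : ENNReal.ofReal τ ≤ deliveryTimeFM g := by
  obtain ⟨hR, hS, hD⟩ := mem_relayEvent.1 hj
  have hSD : ENNReal.ofReal τ ≤ meetingTime g .S .D 0 := by
    rw [meetingTime_zero]; exact ENNReal.ofReal_le_ofReal hS.le
  have hRD : ENNReal.ofReal τ ≤ meetingTime g (.R j) .D 0 := by
    rw [meetingTime_zero]; exact ENNReal.ofReal_le_ofReal hD.le
  unfold deliveryTimeFM
  split_ifs
  · exact hSD
  refine le_iInf₂ fun i hi => ?_
  obtain rfl : i = j := by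
    by_contra hij
    have h1 := hR i
    have h2 := hR j
    simp only [if_true, if_neg hij, Set.mem_Iic, Set.mem_Ioi] at h1 h2
    have h3 : relayTime g ≤ meetingTime g .S (.R j) 0 := iInf_le _ j
    rw [← hi, meetingTime_zero, meetingTime_zero] at h3
    -- Strictness survives `ENNReal.ofReal`, which sends all nonpositive reals to `0`, because the
    -- larger time exceeds `t > 0`.
    have h4 : ENNReal.ofReal (g (s(.S, .R j), 0)) < ENNReal.ofReal (g (s(.S, .R i), 0)) :=
      (ENNReal.ofReal_lt_ofReal_iff (ht.trans h1)).2 (h2.trans_lt h1)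
    exact absurd h3 (not_le.2 h4)
  exact le_min (hSD.trans (meetingTime_zero_le_nextMeeting (fun _ => hg _) _))
    (hRD.trans (meetingTime_zero_le_nextMeeting (fun _ => hg _) _))

/-! ### Probability of the events given the profiles -/

theorem Profile.similarity_le_one {m : ℕ} (x y : Profile m) : x.similarity y ≤ 1 :=
  Real.cos_le_one _

/-- With `y = 1 / (2n) ≤ 1`, one has `e⁻ʸ ≤ 1 / (1 + y) ≤ 1 - y / 2`. -/
theorem one_sub_exp_neg_ge {n : ℕ} (hn : 0 < n) {x : ℝ} (hx : 1 / (2 * n : ℝ) ≤ x) :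
    1 / (4 * n : ℝ) ≤ 1 - Real.exp (-x) := by
  have hn' : (1 : ℝ) ≤ n := by exact_mod_cast hn
  have h1 : Real.exp (-x) ≤ Real.exp (-(1 / (2 * n : ℝ))) := Real.exp_le_exp.2 (by linarith)
  have h2 : Real.exp (-(1 / (2 * n : ℝ))) ≤ (1 + 1 / (2 * n : ℝ))⁻¹ := by
    rw [Real.exp_neg]
    refine inv_anti₀ (by positivity) ?_
    linarith [Real.add_one_le_exp (1 / (2 * n : ℝ))]
  have h3 : (1 + 1 / (2 * n : ℝ))⁻¹ ≤ 1 - 1 / (4 * n : ℝ) := by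
    rw [inv_le_iff_one_le_mul₀ (by positivity)]
    have : (1 - 1 / (4 * n : ℝ)) * (1 + 1 / (2 * n : ℝ)) =
        1 + (2 * n - 1) / (8 * n ^ 2 : ℝ) := by field_simp; ring
    rw [this]
    have : 0 ≤ (2 * n - 1) / (8 * n ^ 2 : ℝ) := div_nonneg (by linarith) (by positivity)
    linarith
  linarith

/-- If `R j` is similar to the source then, given the profiles, `R j` is with probability of order
`1 / n` the first relay met, and independently of that the meetings with the destination take the
time that is to be expected. -/
theorem Mobility.meetingLaw_relayEvent_ge (p : Mobility) (hn : 0 < n)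
    (r : Fin n → Profile (d + 2)) {j : Fin n} (hj : p.k / 2 + p.δ ≤ p.rate r s(.S, .R j)) :
    ENNReal.ofReal (Real.exp (-2) / (4 * n)) ≤
      p.meetingLaw d n r (relayEvent j (1 / (n * (p.k + p.δ)))
        (1 / (p.rate r s(.S, .D) + p.rate r s(.R j, .D)))) := by
  have hk := p.k_pos
  have hδ := p.δ_pos
  have hn' : (0 : ℝ) < n := by exact_mod_cast hn
  -- Every relay meets the source at rate at most `k + δ`, so each one is missed up to `t` with
  -- probability at least `e^(-1/n)`; `R j`, of rate at least `(k + δ) / 2`, is met with probability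
  -- at least `1 - e^(-1/(2n))`. Likewise `τ` is the reciprocal of the total rate towards the
  -- destination, so that both of these meetings come later than `τ` with probability exactly `e⁻¹`.
  set t := 1 / (n * (p.k + p.δ)) with ht
  set τ := 1 / (p.rate r s(.S, .D) + p.rate r s(.R j, .D)) with hτ
  have hr1 := p.rate_pos r s(.S, .D)
  have hr2 := p.rate_pos r s(.R j, .D)
  have ht0 : 0 < t := by positivity
  have hτ0 : 0 < τ := by positivity
  have hφ : Function.Injective fun x => ((decisivePair j x, 0) : Sym2 (Node n) × ℕ) :=
    fun x y h => decisivePair_injective j (congrArg Prod.fst h)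
  have hmeas : ∀ x : Fin n ⊕ Bool, MeasurableSet
      (Sum.elim (fun i => if i = j then Set.Iic t else Set.Ioi t) (fun _ => Set.Ioi τ) x :
        Set ℝ) := by
    rintro (i | b)
    · dsimp only [Sum.elim_inl]; split_ifs <;> measurability
    · exact measurableSet_Ioi
  have hprod := infinitePi_forall_mem
    (fun e : Sym2 (Node n) × ℕ => expMeasure (p.rate r e.1)) hφ hmeas
  change _ ≤ Measure.infinitePi (fun e : Sym2 (Node n) × ℕ => expMeasure (p.rate r e.1))
    (relayEvent j t τ)
  rw [relayEvent, hprod, Fintype.prod_sum_type, Fintype.prod_bool]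
  simp only [Sum.elim_inl, Sum.elim_inr, decisivePair]
  -- The factor `e^(-1/n)` is given away at `i = j` too, so that the product over all `n` relays is
  -- exactly `e⁻¹ / (4n)`.
  have hfirst : ∀ i, ENNReal.ofReal ((if i = j then 1 / (4 * n : ℝ) else 1) *
      Real.exp (-(1 / n : ℝ))) ≤ expMeasure (p.rate r s(.S, .R i))
        (if i = j then Set.Iic t else Set.Ioi t) := by
    intro i
    have hi := p.rate_pos r s(.S, .R i)
    split_ifs with hij
    · subst hij
      rw [expMeasure_Iic hi ht0.le]
      refine ENNReal.ofReal_le_ofReal ((mul_le_of_le_one_right (by positivity)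
        (Real.exp_le_one_iff.2 (by simp))).trans (one_sub_exp_neg_ge hn ?_))
      have : 1 / (2 * n : ℝ) = (p.k + p.δ) / 2 * t := by rw [ht]; field_simp
      rw [this]
      exact mul_le_mul_of_nonneg_right (by linarith) ht0.le
    · rw [expMeasure_Ioi hi ht0.le, one_mul]
      refine ENNReal.ofReal_le_ofReal (Real.exp_le_exp.2 (neg_le_neg ?_))
      have : 1 / (n : ℝ) = (p.k + p.δ) * t := by rw [ht]; field_simp
      rw [this]
      refine mul_le_mul_of_nonneg_right ?_ ht0.le
      have := mul_le_of_le_one_right hk.le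
        (Profile.similarity_le_one (nodeProfile r .S) (nodeProfile r (.R i)))
      simp only [Mobility.rate, Sym2.lift_mk]
      linarith
  have hlast : expMeasure (p.rate r s(.S, .D)) (Set.Ioi τ) *
      expMeasure (p.rate r s(.R j, .D)) (Set.Ioi τ) = ENNReal.ofReal (Real.exp (-1)) := by
    rw [expMeasure_Ioi hr1 hτ0.le, expMeasure_Ioi hr2 hτ0.le,
      ← ENNReal.ofReal_mul (Real.exp_nonneg _), ← Real.exp_add]
    congr 2
    rw [hτ]; field_simp; ring
  rw [hlast]
  have hval : Real.exp (-2) / (4 * n) = (∏ i : Fin n, (if i = j then 1 / (4 * n : ℝ) else 1) *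
      Real.exp (-(1 / n : ℝ))) * Real.exp (-1) := by
    rw [Finset.prod_mul_distrib, Finset.prod_ite_eq' , if_pos (Finset.mem_univ _),
      Finset.prod_const, Finset.card_univ, Fintype.card_fin, ← Real.exp_nat_mul]
    have : (n : ℝ) * -(1 / n : ℝ) = -1 := by field_simp
    rw [this, mul_assoc, ← Real.exp_add]
    norm_num
    ring
  have hnn : ∀ i ∈ (Finset.univ : Finset (Fin n)),
      0 ≤ (if i = j then 1 / (4 * n : ℝ) else 1) * Real.exp (-(1 / n : ℝ)) := fun i _ => by
    split_ifs <;> positivity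
  rw [hval, ENNReal.ofReal_mul (Finset.prod_nonneg hnn), ENNReal.ofReal_prod_of_nonneg hnn]
  exact mul_le_mul_left (Finset.prod_le_prod' fun i _ => hfirst i) _

/-! ### Summation over the relays and averaging over the profiles -/

instance (n : ℕ) : Countable (Node n) :=
  Function.Injective.countable (f := fun A : Node n => match A with
    | .S => (none : Option (Option (Fin n)))
    | .D => some none
    | .R i => some (some i)) <| by
      rintro (_ | _ | _) (_ | _ | _) h <;> simp_all

theorem Mobility.ae_gaps_nonneg (p : Mobility) (d n : ℕ) :
    ∀ᵐ ω ∂p.law d n, ∀ e, 0 ≤ ω.2 e := by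
  have : Countable (Sym2 (Node n)) := Quotient.countable
  rw [ae_all_iff]
  intro e
  refine Measure.ae_compProd_of_ae_ae
    (measurableSet_le measurable_const ((measurable_pi_apply e).comp measurable_snd)) ?_
  refine Eventually.of_forall fun r => ?_
  exact (measurePreserving_eval_infinitePi
    (fun e : Sym2 (Node n) × ℕ => expMeasure (p.rate r e.1)) e).quasiMeasurePreserving.ae
      (ae_nonneg_expMeasure (p.rate_pos r e.1))

/-- The profiles and meetings for which `R j` is similar to the source, is met first, and then
leaves the message undelivered for the time that is to be expected. -/
def Mobility.relayEvent (p : Mobility) (d n : ℕ) (j : Fin n) :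
    Set ((Fin n → Profile (d + 2)) × Gaps n) :=
  {ω | p.k / 2 + p.δ ≤ p.rate ω.1 s(.S, .R j) ∧ ω.2 ∈ PSN.relayEvent j (1 / (n * (p.k + p.δ)))
    (1 / (p.rate ω.1 s(.S, .D) + p.rate ω.1 s(.R j, .D)))}

theorem Mobility.measurableSet_relayEvent (p : Mobility) (d n : ℕ) (j : Fin n) :
    MeasurableSet (p.relayEvent d n j) := by
  have hr : ∀ e, Measurable fun ω : (Fin n → Profile (d + 2)) × Gaps n => p.rate ω.1 e :=
    fun e => (p.measurable_rate e).comp measurable_fst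
  have hg : ∀ e, Measurable fun ω : (Fin n → Profile (d + 2)) × Gaps n => ω.2 e :=
    fun e => (measurable_pi_apply e).comp measurable_snd
  have hτ := ((hr s(.S, .D)).add (hr s(.R j, .D))).const_div 1
  simp only [Mobility.relayEvent, mem_relayEvent]
  refine (measurableSet_le measurable_const (hr _)).inter (.inter ?_
    ((measurableSet_lt hτ (hg _)).inter (measurableSet_lt hτ (hg _))))
  change MeasurableSet {ω : (Fin n → Profile (d + 2)) × Gaps n | ∀ i, _}
  rw [Set.ofPred_forall]
  refine MeasurableSet.iInter fun i => hg _ ?_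
  split_ifs <;> measurability

/-- The events are pairwise disjoint, so the integrals of the delivery time over them sum to at most
its expectation. -/
theorem Mobility.sum_setLIntegral_le_expectedTimeFM (p : Mobility) (d : ℕ) (hn : 0 < n) :
    ∑ j : Fin n, ∫⁻ ω in p.relayEvent d n j,
      ENNReal.ofReal (1 / (p.rate ω.1 s(.S, .D) + p.rate ω.1 s(.R j, .D))) ∂p.law d n ≤
        p.expectedTimeFM d n := by
  have hn' : (0 : ℝ) < n := by exact_mod_cast hn
  have ht : 0 < 1 / (n * (p.k + p.δ)) := by
    have := add_pos p.k_pos p.δ_pos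
    positivity
  have hdisj : Set.PairwiseDisjoint ((Finset.univ : Finset (Fin n)) : Set (Fin n))
      (p.relayEvent d n) := fun i _ j _ hij => Set.disjoint_left.2 fun ω hi hj =>
    hij (eq_of_mem_relayEvent hi.2 hj.2)
  calc ∑ j : Fin n, ∫⁻ ω in p.relayEvent d n j,
        ENNReal.ofReal (1 / (p.rate ω.1 s(.S, .D) + p.rate ω.1 s(.R j, .D))) ∂p.law d n
      ≤ ∑ j : Fin n, ∫⁻ ω in p.relayEvent d n j, deliveryTimeFM ω.2 ∂p.law d n := by
        refine Finset.sum_le_sum fun j _ =>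
          setLIntegral_mono_ae' (p.measurableSet_relayEvent d n j) ?_
        filter_upwards [p.ae_gaps_nonneg d n] with ω hω hj
        exact le_deliveryTimeFM ht hω hj.2
    _ = ∫⁻ ω in ⋃ j ∈ (Finset.univ : Finset (Fin n)), p.relayEvent d n j,
          deliveryTimeFM ω.2 ∂p.law d n :=
        (lintegral_biUnion_finset hdisj (fun j _ => p.measurableSet_relayEvent d n j) _).symm
    _ ≤ p.expectedTimeFM d n := setLIntegral_le_lintegral _ _

/-- A bound, up to constants, for the contribution of a relay node of profile `x` to the expected
delivery time, multiplied by the number of relay nodes. -/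
noncomputable def Mobility.relayDelay (p : Mobility) {d : ℕ} (x : Profile (d + 2)) : ℝ≥0∞ :=
  if 1 / 2 ≤ (Profile.pure 0).similarity x then
    ENNReal.ofReal (1 / (2 * p.δ + p.k * x.similarity (Profile.pure 1))) else 0

theorem Profile.measurable_similarity {m : ℕ} (y : Profile m) :
    Measurable fun x : Profile m => x.similarity y := by
  simp only [Profile.similarity_eq]
  have : ∀ i, Continuous fun x : Profile m => x.vec i := fun i => by
    unfold Profile.vec; fun_prop
  exact Finset.measurable_sum _ fun i _ => (this i).measurable.mul_const _

theorem Profile.similarity_comm {m : ℕ} (x y : Profile m) : x.similarity y = y.similarity x := by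
  simp only [Profile.similarity, InnerProductGeometry.angle_comm]

theorem Profile.vec_pure {m : ℕ} (i j : Fin m) :
    (Profile.pure i).vec j = if j = i then 1 else 0 :=
  PiLp.single_apply 2 ℝ i 1 j

theorem Profile.similarity_pure {m : ℕ} (x : Profile m) (i : Fin m) :
    x.similarity (Profile.pure i) = x.vec i := by
  rw [Profile.similarity_eq, Finset.sum_eq_single i]
  · rw [Profile.vec_pure, if_pos rfl, mul_one]
  · intro j _ hj
    rw [Profile.vec_pure, if_neg hj, mul_zero]
  · simp

theorem Mobility.measurable_relayDelay (p : Mobility) (d : ℕ) :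
    Measurable (p.relayDelay : Profile (d + 2) → ℝ≥0∞) := by
  unfold Mobility.relayDelay
  simp only [Profile.similarity_comm (Profile.pure 0)]
  refine Measurable.ite (measurableSet_le measurable_const (Profile.measurable_similarity _)) ?_
    measurable_const
  exact ((((Profile.measurable_similarity _).const_mul _).const_add _).const_div _).ennreal_ofReal

theorem Mobility.rate_source_destination (p : Mobility) (r : Fin n → Profile (d + 2)) :
    p.rate r s(.S, .D) = p.δ := by
  simp [Mobility.rate, nodeProfile, Profile.similarity_pure, Profile.vec_pure]

/-- Given the profiles, the integrand is constant, so the inner integral is this constant times the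
conditional probability of the event. It depends on the profile of `R j` alone, since source and
destination are orthogonal and meet at rate `δ`. -/
theorem Mobility.lintegral_relayDelay_le_setLIntegral (p : Mobility) (d : ℕ) (hn : 0 < n)
    (j : Fin n) :
    ENNReal.ofReal (Real.exp (-2) / (4 * n)) * ∫⁻ x, p.relayDelay x ∂profileLaw d ≤
      ∫⁻ ω in p.relayEvent d n j,
        ENNReal.ofReal (1 / (p.rate ω.1 s(.S, .D) + p.rate ω.1 s(.R j, .D))) ∂p.law d n := by
  have hE := p.measurableSet_relayEvent d n j
  have hτ : Measurable fun ω : (Fin n → Profile (d + 2)) × Gaps n =>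
      ENNReal.ofReal (1 / (p.rate ω.1 s(.S, .D) + p.rate ω.1 s(.R j, .D))) :=
    ((((p.measurable_rate _).add (p.measurable_rate _)).const_div 1).comp
      measurable_fst).ennreal_ofReal
  rw [← lintegral_indicator hE, Mobility.law, Measure.lintegral_compProd (hτ.indicator hE),
    ← (measurePreserving_eval (fun _ : Fin n => profileLaw d) j).lintegral_comp
      (p.measurable_relayDelay d),
    ← lintegral_const_mul (f := fun r : Fin n → Profile (d + 2) =>
      p.relayDelay (Function.eval j r)) _ ((p.measurable_relayDelay d).comp (measurable_pi_apply j))]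
  refine lintegral_mono fun r => ?_
  simp only [Function.eval, Mobility.relayDelay]
  split_ifs with hj
  swap
  · simp
  have hj' : p.k / 2 + p.δ ≤ p.rate r s(.S, .R j) := by
    simp only [Mobility.rate, Sym2.lift_mk, nodeProfile]
    nlinarith [p.k_pos]
  have hrate : p.rate r s(.S, .D) + p.rate r s(.R j, .D) =
      2 * p.δ + p.k * (r j).similarity (Profile.pure 1) := by
    rw [p.rate_source_destination]
    simp only [Mobility.rate, Sym2.lift_mk, nodeProfile]
    ring
  have hsec : MeasurableSet (PSN.relayEvent j (1 / (n * (p.k + p.δ)))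
      (1 / (p.rate r s(.S, .D) + p.rate r s(.R j, .D)))) := by
    convert! measurable_prodMk_left (x := r) hE using 1
    ext g
    simp [Mobility.relayEvent, hj']
  have hind : ∀ g, (p.relayEvent d n j).indicator (fun ω =>
      ENNReal.ofReal (1 / (p.rate ω.1 s(.S, .D) + p.rate ω.1 s(.R j, .D)))) (r, g) =
      (PSN.relayEvent j (1 / (n * (p.k + p.δ)))
        (1 / (p.rate r s(.S, .D) + p.rate r s(.R j, .D)))).indicator (fun _ =>
          ENNReal.ofReal (1 / (2 * p.δ + p.k * (r j).similarity (Profile.pure 1)))) g := by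
    intro g
    by_cases hg : g ∈ PSN.relayEvent j (1 / (n * (p.k + p.δ)))
      (1 / (p.rate r s(.S, .D) + p.rate r s(.R j, .D)))
    · have hω : (r, g) ∈ p.relayEvent d n j := ⟨hj', hg⟩
      rw [Set.indicator_of_mem hω, Set.indicator_of_mem hg, hrate]
    · have hω : (r, g) ∉ p.relayEvent d n j := fun h => hg h.2
      rw [Set.indicator_of_notMem hω, Set.indicator_of_notMem hg]
  simp only [hind]
  rw [lintegral_indicator hsec, setLIntegral_const, mul_comm]
  exact mul_le_mul_right (p.meetingLaw_relayEvent_ge hn r hj') _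

/-- The relays are identically distributed: `n` equal contributions cancel the `1 / n` in the
probability of being met first. -/
theorem Mobility.lintegral_relayDelay_le_expectedTimeFM (p : Mobility) (d : ℕ) (hn : 0 < n) :
    ENNReal.ofReal (Real.exp (-2) / 4) * ∫⁻ x, p.relayDelay x ∂profileLaw d ≤
      p.expectedTimeFM d n := by
  refine le_trans ?_ (p.sum_setLIntegral_le_expectedTimeFM d hn)
  refine le_trans (le_of_eq ?_)
    (Finset.sum_le_sum fun j _ => p.lintegral_relayDelay_le_setLIntegral d hn j)
  have hn' : (0 : ℝ) < n := by exact_mod_cast hn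
  rw [Finset.sum_const, Finset.card_univ, Fintype.card_fin, nsmul_eq_mul, ← mul_assoc,
    ← ENNReal.ofReal_natCast, ← ENNReal.ofReal_mul hn'.le]
  congr 2
  field_simp

/-! ### The integral over the angle -/

/-- For `α ≤ 1`, `cos α ≥ 1 - α² / 2 ≥ 1 / 2`, while the similarity to the destination is `sin α`
times a coordinate of a unit vector, hence at most `α`. Discarding the direction `u` makes the bound
uniform in the number of interests. -/
theorem Mobility.relayDelay_polar_ge (p : Mobility) {K : ℝ} (hK : p.k ≤ K)
    {α : Set.Icc (0 : ℝ) (Real.pi / 2)} (hα : (α : ℝ) ≤ 1) (u : Profile (d + 1)) :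
    ENNReal.ofReal (1 / (2 * p.δ + K * α)) ≤ p.relayDelay (Profile.polar α u) := by
  have hδ := p.δ_pos
  have hk := p.k_pos
  have hα0 : (0 : ℝ) ≤ α := α.2.1
  have h0 : (Profile.polar α u).vec 0 = Real.cos α := rfl
  have h1 : (Profile.polar α u).vec 1 = Real.sin α * u.vec 0 := rfl
  have hu : u.vec 0 ≤ 1 := by
    rw [← Profile.similarity_pure]; exact Profile.similarity_le_one _ _
  have hcos : 1 / 2 ≤ Real.cos α := by
    nlinarith [Real.one_sub_sq_div_two_le_cos (x := (α : ℝ))]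
  have hv : (Profile.polar α u).vec 1 ≤ α := by
    rw [h1]
    refine (mul_le_of_le_one_right (Real.sin_nonneg_of_nonneg_of_le_pi hα0 ?_) hu).trans
      (Real.sin_le hα0)
    linarith [Real.two_le_pi]
  have hv0 : 0 ≤ (Profile.polar α u).vec 1 := (Profile.polar α u).2 1
  rw [Mobility.relayDelay, Profile.similarity_comm, Profile.similarity_pure, h0, if_pos hcos,
    Profile.similarity_pure]
  refine ENNReal.ofReal_le_ofReal (one_div_le_one_div_of_le (by positivity) ?_)
  have := mul_le_mul hK hv hv0 (hk.le.trans hK)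
  linarith

/-- The angle has density `2 / π`, and `K⁻¹ log (a + K x)` is a primitive of the integrand; `[0, 1]`
lies inside `[0, π/2]`. -/
theorem lintegral_angleLaw_ge {a K : ℝ} (ha : 0 < a) (hK : 0 < K) :
    ENNReal.ofReal (2 / (Real.pi * K) * Real.log (1 + K / a)) ≤
      ∫⁻ α in {α : Set.Icc (0 : ℝ) (Real.pi / 2) | (α : ℝ) ≤ 1},
        ENNReal.ofReal (1 / (a + K * α)) ∂angleLaw := by
  have hpi := Real.pi_pos
  have hint : ∫ x in (0 : ℝ)..1, 1 / (a + K * x) = K⁻¹ * Real.log (1 + K / a) := by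
    have h := intervalIntegral.integral_comp_add_mul (fun x : ℝ => x⁻¹) hK.ne' a (a := 0) (b := 1)
    simp only [mul_zero, add_zero, mul_one, smul_eq_mul,
      integral_inv_of_pos ha (add_pos ha hK)] at h
    simp only [one_div, h]
    congr 2
    field_simp
  have hcont : ContinuousOn (fun x : ℝ => 1 / (a + K * x)) (Set.Icc 0 1) :=
    ContinuousOn.div (by fun_prop) (by fun_prop) fun x hx => by
      have := mul_nonneg hK.le hx.1
      linarith
  have hI : ENNReal.ofReal (K⁻¹ * Real.log (1 + K / a)) =
      ∫⁻ x in Set.Icc (0 : ℝ) 1, ENNReal.ofReal (1 / (a + K * x)) := by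
    rw [← hint, intervalIntegral.integral_of_le zero_le_one, ← integral_Icc_eq_integral_Ioc,
      ofReal_integral_eq_lintegral_ofReal hcont.integrableOn_Icc]
    filter_upwards [ae_restrict_mem measurableSet_Icc] with x hx
    have := mul_nonneg hK.le hx.1
    exact div_nonneg zero_le_one (by linarith)
  have hmass : ((volume : Measure ℝ).comap Subtype.val :
      Measure (Set.Icc (0 : ℝ) (Real.pi / 2))) Set.univ = ENNReal.ofReal (Real.pi / 2) := by
    rw [(MeasurableEmbedding.subtype_coe measurableSet_Icc).comap_apply]
    rw [Set.image_univ, Subtype.range_coe, Real.volume_Icc, sub_zero]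
  have hs : MeasurableSet {α : Set.Icc (0 : ℝ) (Real.pi / 2) | (α : ℝ) ≤ 1} :=
    measurableSet_le measurable_subtype_coe measurable_const
  have hset : Set.Icc (0 : ℝ) 1 = Set.Icc (0 : ℝ) (Real.pi / 2) ∩ Set.Iic 1 := by
    ext x
    simp only [Set.mem_Icc, Set.mem_inter_iff, Set.mem_Iic]
    constructor
    · rintro ⟨h0, h1⟩; exact ⟨⟨h0, by linarith [Real.two_le_pi]⟩, h1⟩
    · rintro ⟨⟨h0, -⟩, h1⟩; exact ⟨h0, h1⟩
  rw [angleLaw, ProbabilityTheory.cond, Measure.restrict_univ, Measure.restrict_smul,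
    lintegral_smul_measure, hmass, ← lintegral_indicator hs]
  have hsub : ∫⁻ α : Set.Icc (0 : ℝ) (Real.pi / 2),
      {α : Set.Icc (0 : ℝ) (Real.pi / 2) | (α : ℝ) ≤ 1}.indicator
        (fun α => ENNReal.ofReal (1 / (a + K * (α : ℝ)))) α
          ∂((volume : Measure ℝ).comap Subtype.val) =
      ∫⁻ x in Set.Icc (0 : ℝ) (Real.pi / 2),
        (Set.Iic (1 : ℝ)).indicator (fun x => ENNReal.ofReal (1 / (a + K * x))) x :=
    lintegral_subtype_comap measurableSet_Icc
      ((Set.Iic (1 : ℝ)).indicator fun x => ENNReal.ofReal (1 / (a + K * x)))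
  rw [hsub, setLIntegral_indicator measurableSet_Iic, Set.inter_comm, ← hset, ← hI, smul_eq_mul,
    ← ENNReal.ofReal_inv_of_pos (by positivity), ← ENNReal.ofReal_mul (by positivity)]
  refine le_of_eq (congrArg _ ?_)
  field_simp

theorem Mobility.lintegral_relayDelay_ge (p : Mobility) (d : ℕ) {K : ℝ} (hK : p.k ≤ K) :
    ENNReal.ofReal (2 / (Real.pi * K) * Real.log (1 + K / (2 * p.δ))) ≤
      ∫⁻ x, p.relayDelay x ∂profileLaw d := by
  have hs : MeasurableSet {α : Set.Icc (0 : ℝ) (Real.pi / 2) | (α : ℝ) ≤ 1} :=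
    measurableSet_le measurable_subtype_coe measurable_const
  have hpolar := (Profile.continuous_polar (d + 1)).measurable
  rw [profileLaw, lintegral_map (p.measurable_relayDelay d) hpolar,
    lintegral_prod (fun q : Set.Icc (0 : ℝ) (Real.pi / 2) × Profile (d + 1) =>
      p.relayDelay (Profile.polar q.1 q.2)) ((p.measurable_relayDelay d).comp hpolar).aemeasurable]
  refine (lintegral_angleLaw_ge (mul_pos two_pos p.δ_pos) (p.k_pos.trans_le hK)).trans ?_
  refine le_trans (setLIntegral_mono' hs fun α hα => ?_) (setLIntegral_le_lintegral _ _)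
  calc ENNReal.ofReal (1 / (2 * p.δ + K * α))
      = ∫⁻ _ : Profile (d + 1), ENNReal.ofReal (1 / (2 * p.δ + K * α)) ∂orthantLaw (d + 1) := by
        simp
    _ ≤ _ := lintegral_mono fun u => p.relayDelay_polar_ge hK hα u

/-! ### Logarithmic growth and the conclusion -/

/-- Bernoulli's inequality with exponent `m = min 1 b ≤ 1` gives `x ^ m ≤ 1 + m (x - 1) ≤ 1 + b x`.
-/
theorem mul_log_le_log_one_add_mul {b x : ℝ} (hb : 0 < b) (hx : 1 ≤ x) :
    min 1 b * Real.log x ≤ Real.log (1 + b * x) := by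
  have hm : 0 < min 1 b := lt_min one_pos hb
  have h := _root_.rpow_one_add_le_one_add_mul_self (s := x - 1) (by linarith) hm.le
    (min_le_left 1 b)
  rw [add_sub_cancel] at h
  rw [← Real.log_rpow (by linarith)]
  refine Real.log_le_log (Real.rpow_pos_of_pos (by linarith) _) (h.trans ?_)
  nlinarith [min_le_right 1 b]

/-- The expected delivery time of FirstMeeting routing grows at least like `log (1 / δ)`, uniformly
in the number of relay nodes, the number of interests, and `k ≤ K`. -/
theorem exists_log_le_expectedTimeFM {K : ℝ} (hK : 0 < K) :
    ∃ c > 0, ∀ (d n : ℕ) (p : Mobility), 0 < n → p.k ≤ K →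
      ENNReal.ofReal (c * Real.log (1 / p.δ)) ≤ p.expectedTimeFM d n := by
  have hpi := Real.pi_pos
  have hm : 0 < min 1 (K / 2) := lt_min one_pos (half_pos hK)
  refine ⟨Real.exp (-2) / 4 * (2 / (Real.pi * K) * min 1 (K / 2)), by positivity,
    fun d n p hn hp => ?_⟩
  have hδ := p.δ_pos
  -- For `δ ≥ 1` the logarithm is nonpositive and `ENNReal.ofReal` truncates the bound to `0`.
  rcases le_or_gt 1 p.δ with h1 | h1
  · have hlog : Real.log (1 / p.δ) ≤ 0 :=
      Real.log_nonpos (by positivity) ((div_le_one hδ).2 h1)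
    rw [ENNReal.ofReal_of_nonpos (mul_nonpos_of_nonneg_of_nonpos (by positivity) hlog)]
    exact zero_le
  refine le_trans ?_ (p.lintegral_relayDelay_le_expectedTimeFM d hn)
  rw [mul_assoc, ENNReal.ofReal_mul (by positivity)]
  refine mul_le_mul_right ((ENNReal.ofReal_le_ofReal ?_).trans (p.lintegral_relayDelay_ge d hp)) _
  rw [mul_assoc]
  refine mul_le_mul_of_nonneg_left ?_ (by positivity)
  have h := mul_log_le_log_one_add_mul (half_pos hK) ((one_le_div hδ).2 h1.le)
  have he : K / 2 * (1 / p.δ) = K / (2 * p.δ) := by field_simp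
  rwa [he] at h

end PSN

theorem mainTheorem1 (K : ℝ) (hK : 0 < K) :
    (∃ c > 0, ∃ c' > 0, ∀ (d n : ℕ) (p : PSN.Mobility), 2 ≤ n → p.k ≤ K →
      ENNReal.ofReal (min (c * Real.log (1 / p.δ)) (c' * (n / Real.log n))) ≤
        p.expectedTimeFM d n) ∧
    ∀ (d : ℕ) (p : ℕ → PSN.Mobility), (∀ n, (p n).k ≤ K) →
      Tendsto (fun n => (p n).δ) atTop (𝓝 0) →
      Tendsto (fun n => (p n).expectedTimeFM d n) atTop (𝓝 ⊤) := by
  obtain ⟨c, hc, h⟩ := PSN.exists_log_le_expectedTimeFM hK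
  -- The value `c' = 1` is arbitrary: the first term of the minimum is already a lower bound.
  refine ⟨⟨c, hc, 1, one_pos, fun d n p hn hp => ?_⟩, fun d p hp hδ => ?_⟩
  · exact (ENNReal.ofReal_le_ofReal (min_le_left _ _)).trans (h d n p (by omega) hp)
  · have hδ' : Tendsto (fun n => (p n).δ) atTop (𝓝[>] 0) :=
      tendsto_nhdsWithin_iff.2 ⟨hδ, Eventually.of_forall fun n => (p n).δ_pos⟩
    have hlog : Tendsto (fun n => c * Real.log (1 / (p n).δ)) atTop atTop := by
      simp only [one_div]
      exact (Real.tendsto_log_atTop.comp (tendsto_inv_nhdsGT_zero.comp hδ')).const_mul_atTop hc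
    refine tendsto_nhds_top_mono (ENNReal.tendsto_ofReal_atTop.comp hlog) ?_
    filter_upwards [eventually_gt_atTop 0] with n hn
    exact h d n (p n) hn (hp n)
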